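/- A JB$^*$-triple is a complex Banach space $E$ with a triple product $\{\cdot,\cdot,\cdot\}:E^3\to E$ that is linear and symmetric in the outer variables and conjugate linear in the middle one, such that, writing $L(a,b)x=\{a,b,x\}$: (1) $\{a,b,\{x,y,z\}\}=\{\{a,b,x\},y,z\}-\{x,\{b,a,y\},z\}+\{x,y,\{a,b,z\}\}$ for all $a,b,x,y,z\in E$; (2) every $L(a,a)$ is a bounded hermitian operator with non-negative spectrum (a bounded operator $T$ on $E$ is hermitian if $\phi(T)\in\mathbb R$ for each bounded linear functional $\phi$ on the space of bounded operators on $E$ with $\|\phi\|\le 1$ and $\phi(I)=1$); (3) $\|\{x,x,x\}\|=\|x\|^3$ for all $x\in E$. Let $e$ be a tripotent in a JB$^*$-triple $E$, i.e. $\{e,e,e\}=e$. For $k=0,1,2$ let $E_k(e)=\{x\in E:\{e,e,x\}=\tfrac k2 x\}$. The space $E_2(e)$ is a JB$^*$-algebra with product $x\circ_e y=\{x,e,y\}$ and involution $x^{*_e}=\{e,x,e\}$; an element $x\in E_2(e)$ is positive, $x\ge 0$, if $x=b\circ_e b$ for some $b\in E_2(e)$ with $b^{*_e}=b$. Then the sesquilinear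 mapping $$F_1:E_1(e)\times E_1(e)\to E_2(e),\qquad F_1(a,b)=\{a,b,e\},$$ is hermitian and positive definite, that is, for all $a,b\in E_1(e)$: $F_1(a,b)^{*_e}=F_1(b,a)$; $F_1(a,a)\ge 0$ in $E_2(e)$; and $F_1(a,a)=0$ if and only if $a=0$. -/

import Mathlib

/-- The set `D(X, u)` of states of a complex normed space `X` relative to `u`. -/
def stateSet (X : Type*) [NormedAddCommGroup X] [NormedSpace ℂ X] (u : X) :
    Set (X →L[ℂ] ℂ) :=
  {φ | ‖φ‖ ≤ 1 ∧ φ u = 1}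

/-- The numerical range `V(X, u, x)` of `x` relative to `u`. -/
def numRange (X : Type*) [NormedAddCommGroup X] [NormedSpace ℂ X] (u x : X) : Set ℂ :=
  (fun φ : X →L[ℂ] ℂ => φ x) '' stateSet X u

/-- A bounded operator `T` on `X` is hermitian if its numerical range `V(BL(X), I, T)`
is contained in `ℝ`. -/
def IsHermitianOp {X : Type*} [NormedAddCommGroup X] [NormedSpace ℂ X] (T : X →L[ℂ] X) : Prop :=
  ∀ z ∈ numRange (X →L[ℂ] X) (ContinuousLinearMap.id ℂ X) T, z.im = 0

/-- JB*-triples: a complex Banach space with a triple product `{a, b, c}`, written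
`triple a b c`, which is complex linear in `a` and `c` and conjugate linear in `b`, symmetric in
the outer variables, and subject to the three axioms.  The operator `L(a, b)` is `triple a b`. -/
class JBStarTriple (E : Type*) [NormedAddCommGroup E] [NormedSpace ℂ E] [CompleteSpace E] where
  /-- the triple product -/
  triple : E →ₗ[ℂ] E →ₗ⋆[ℂ] E →ₗ[ℂ] E
  /-- symmetry in the outer variables -/
  triple_symm : ∀ a b c : E, triple a b c = triple c b a
  /-- the Jordan identity -/
  jordan : ∀ a b x y z : E,
    triple a b (triple x y z) =
      triple (triple a b x) y z - triple x (triple b a y) z + triple x y (triple a b z)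
  /-- `L(a, a)` is a bounded hermitian operator with non-negative spectrum -/
  hermitian_nonneg : ∀ a : E, ∃ T : E →L[ℂ] E, (∀ x : E, T x = triple a a x) ∧
    IsHermitianOp T ∧ ∀ z ∈ spectrum ℂ T, 0 ≤ z.re ∧ z.im = 0
  /-- the norm axiom -/
  norm_cube : ∀ x : E, ‖triple x x x‖ = ‖x‖ ^ 3

namespace JBStarTriple

/-- `e` is a tripotent if `{e, e, e} = e`. -/
def IsTripotent {E : Type*} [NormedAddCommGroup E] [NormedSpace ℂ E] [CompleteSpace E]
    [JBStarTriple E] (e : E) : Prop :=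
  triple e e e = e

/-- The Peirce subspace `E_k(e)`: the `k/2`-eigenspace of `L(e, e)`. -/
noncomputable def peirce {E : Type*} [NormedAddCommGroup E] [NormedSpace ℂ E] [CompleteSpace E]
    [JBStarTriple E] (e : E) (k : ℕ) : Submodule ℂ E :=
  Module.End.eigenspace (triple e e) ((k : ℂ) / 2)

theorem mem_peirce {E : Type*} [NormedAddCommGroup E] [NormedSpace ℂ E] [CompleteSpace E]
    [JBStarTriple E] {e : E} {k : ℕ} {x : E} :
    x ∈ peirce e k ↔ triple e e x = ((k : ℂ) / 2) • x :=
  Module.End.mem_eigenspace_iff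

theorem mem_peirce_two {E : Type*} [NormedAddCommGroup E] [NormedSpace ℂ E] [CompleteSpace E]
    [JBStarTriple E] {e : E} {x : E} : x ∈ peirce e 2 ↔ triple e e x = x := by
  rw [mem_peirce]; norm_num

theorem triple_mem_of_one_one {E : Type*} [NormedAddCommGroup E] [NormedSpace ℂ E]
    [CompleteSpace E] [JBStarTriple E] {e : E} (he : IsTripotent e) {a b : E}
    (ha : a ∈ peirce e 1) (hb : b ∈ peirce e 1) : triple a b e ∈ peirce e 2 := by
  rw [mem_peirce] at ha hb
  rw [mem_peirce_two, jordan, ha, hb, show triple e e e = e from he]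
  have h2 : (starRingEnd ℂ) 2 = 2 := Complex.conj_ofNat 2
  simp [h2]

theorem triple_mem_of_two_two {E : Type*} [NormedAddCommGroup E] [NormedSpace ℂ E]
    [CompleteSpace E] [JBStarTriple E] {e : E} {a b c : E}
    (ha : a ∈ peirce e 2) (hb : b ∈ peirce e 2) (hc : c ∈ peirce e 2) :
    triple a b c ∈ peirce e 2 := by
  rw [mem_peirce_two] at *
  rw [jordan, ha, hb, hc]
  simp

/-- The Jordan product `a ∘ₑ b = {a, e, b}` of `E_2(e)`. -/
def peirceTwoMul {E : Type*} [NormedAddCommGroup E] [NormedSpace ℂ E] [CompleteSpace E]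
    [JBStarTriple E] {e : E} (he : IsTripotent e) (a b : peirce e 2) : peirce e 2 :=
  ⟨triple (a : E) e (b : E), triple_mem_of_two_two a.2 (mem_peirce_two.2 he) b.2⟩

/-- The involution `a ↦ {e, a, e}` of `E_2(e)`. -/
def peirceTwoStar {E : Type*} [NormedAddCommGroup E] [NormedSpace ℂ E] [CompleteSpace E]
    [JBStarTriple E] {e : E} (he : IsTripotent e) (a : peirce e 2) : peirce e 2 :=
  ⟨triple e (a : E) e, triple_mem_of_two_two (mem_peirce_two.2 he) a.2 (mem_peirce_two.2 he)⟩

/-- `x ≥ 0` in the JB*-algebra `E_2(e)`: `x` is the square of a self-adjoint element. -/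
def IsPositive {E : Type*} [NormedAddCommGroup E] [NormedSpace ℂ E] [CompleteSpace E]
    [JBStarTriple E] {e : E} (he : IsTripotent e) (x : peirce e 2) : Prop :=
  ∃ b : peirce e 2, peirceTwoStar he b = b ∧ peirceTwoMul he b b = x

/-- The sesquilinear mapping `F₁ : E_1(e) × E_1(e) → E_2(e)`, `F₁(a, b) = {a, b, e}`. -/
noncomputable def F₁ {E : Type*} [NormedAddCommGroup E] [NormedSpace ℂ E] [CompleteSpace E]
    [JBStarTriple E] {e : E} (he : IsTripotent e) :
    peirce e 1 →ₗ[ℂ] peirce e 1 →ₗ⋆[ℂ] peirce e 2 :=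
  LinearMap.mk₂'ₛₗ (RingHom.id ℂ) (starRingEnd ℂ)
    (fun a b => ⟨triple (a : E) (b : E) e, triple_mem_of_one_one he a.2 b.2⟩)
    (by intros; ext; simp) (by intros; ext; simp) (by intros; ext; simp) (by intros; ext; simp)

end JBStarTriple

/-! Symmetry is one use of the Jordan identity. For positivity, `T = L(a,a)` is hermitian, so
`exp(itT)` is a contraction for real `t`. Since the spectrum is non-negative, Phragmén–Lindelöf
makes `exp(-zT)` a contraction on the right half-plane. Expanding at `0` gives arbitrarily small
upper slopes for `‖1 - tT‖`; applied to `e`, this becomes `‖e - t{a,a,e}‖ ≤ 1 + εt`. The element `x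
= {a,a,e}` is self-adjoint in `E_2(e)`, and its powers generate a commutative C*-algebra with unit
`e`. There the estimate forces the spectrum of `x` to be non-negative, so `x` has a self-adjoint
square root.

For definiteness, let `{a,a,e} = 0`. Dividing `F₁(a+sb, a+sb) ≥ 0` by `s` and letting `s → 0` gives
`{a,b,e} + {b,a,e} ≥ 0`. Using `-b` and `ib` as well gives `{b,a,e} = 0` for every `b ∈ E_1(e)`
(`triple_eq_zero`). Put `A = L(a,e)` and `B = L(e,a)`. Peirce arithmetic gives `B² = 0` and `A²B =
0`, and the Jordan identity gives `L(a,a) = 2(AB - BA)`. The spectrum of this commutator is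
symmetric about `0` (`neg_mem_spectrum_commutator`) and also non-negative, hence contains only `0`.
A hermitian operator with such spectrum vanishes by Liouville, so `{a,a,a} = 0` and the norm axiom
gives `a = 0`. -/

open Filter Topology

/-! ### Exponentials and contraction semigroups in Banach algebras. -/

section BanachAlgebra

variable {𝒜 : Type*} [NormedRing 𝒜] [NormedAlgebra ℂ 𝒜] [CompleteSpace 𝒜]

theorem commute_exp_add (a b : 𝒜) (h : Commute a b) :
    NormedSpace.exp (a + b) = NormedSpace.exp a * NormedSpace.exp b := by
  let _ : NormedAlgebra ℚ 𝒜 := NormedAlgebra.restrictScalars ℚ ℂ 𝒜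
  exact NormedSpace.exp_add_of_commute h

theorem exp_smul_natCast_mul (Z : 𝒜) (s : ℂ) (n : ℕ) :
    NormedSpace.exp (((n : ℂ) * s) • Z) = NormedSpace.exp (s • Z) ^ n := by
  let _ : NormedAlgebra ℚ 𝒜 := NormedAlgebra.restrictScalars ℚ ℂ 𝒜
  rw [← NormedSpace.exp_nsmul, mul_smul, Nat.cast_smul_eq_nsmul]

theorem norm_exp_smul_le [NormOneClass 𝒜] (Z : 𝒜) (s : ℂ) :
    ‖NormedSpace.exp (s • Z)‖ ≤ Real.exp (‖Z‖ * ‖s‖) := by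
  have h1 := NormedSpace.exp_series_hasSum_exp' (𝕂 := ℂ) (s • Z)
  have h2 := NormedSpace.exp_series_hasSum_exp' (𝕂 := ℝ) (‖Z‖ * ‖s‖)
  rw [← Real.exp_eq_exp_ℝ] at h2
  refine h1.norm_le_of_bounded h2 fun n => ?_
  rw [norm_smul, norm_inv, Complex.norm_natCast, smul_eq_mul]
  gcongr
  exact (norm_pow_le _ _).trans (by rw [norm_smul, mul_comm])

/-- If `1 - tZ` is bounded below by `1` for all real `t`, then `exp (tZ)` is a contraction. -/
theorem norm_exp_le_one_of_norm_le_norm_sub [NormOneClass 𝒜] {Z : 𝒜}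
    (h : ∀ (t : ℝ) (S : 𝒜), ‖S‖ ≤ ‖S - (t : ℂ) • (Z * S)‖) (t : ℝ) :
    ‖NormedSpace.exp ((t : ℂ) • Z)‖ ≤ 1 := by
  -- For real `u` the hypothesis bounds `‖exp(uZ)‖` by the norm of this function, which is `1 +
  -- o(u)`. Taking `n`-th powers at `u = t/n` then yields `e^{ε|t|}` for every `ε`.
  have hG : HasDerivAt (fun u : ℂ => NormedSpace.exp (u • Z) - u • (Z * NormedSpace.exp (u • Z)))
      0 0 := by
    have h0 := hasDerivAt_exp_smul_const (𝕂 := ℂ) Z 0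
    have h1 := h0.sub ((hasDerivAt_id (0 : ℂ)).smul (h0.const_mul Z))
    simp only [zero_smul, NormedSpace.exp_zero, one_mul, mul_one, id_eq, one_smul, zero_add,
      sub_self] at h1
    exact h1
  have hlit := hG.isLittleO
  have key : ∀ ε : ℝ, 0 < ε → ∀ᶠ s : ℂ in 𝓝 0, s.im = 0 →
      ‖NormedSpace.exp (s • Z)‖ ≤ 1 + ε * ‖s‖ := by
    intro ε hε
    filter_upwards [hlit.bound hε] with s hs hs0
    have hs' : s = ((s.re : ℝ) : ℂ) := Complex.ext rfl (by simpa using hs0)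
    have h2 := h s.re (NormedSpace.exp (s • Z))
    rw [← hs'] at h2
    simp only [zero_smul, NormedSpace.exp_zero, sub_zero, smul_zero] at hs
    calc _ ≤ _ := h2
      _ = ‖1 + (NormedSpace.exp (s • Z) - s • (Z * NormedSpace.exp (s • Z)) - 1)‖ := by
        congr 1; abel
      _ ≤ ‖(1 : 𝒜)‖ + _ := norm_add_le _ _
      _ ≤ _ := by rw [norm_one]; gcongr
  have key2 : ∀ ε : ℝ, 0 < ε → ‖NormedSpace.exp ((t : ℂ) • Z)‖ ≤ Real.exp (ε * |t|) := by
    intro ε hε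
    have hlim : Tendsto (fun n : ℕ => ((t / n : ℝ) : ℂ)) atTop (𝓝 0) := by
      have := (tendsto_const_div_atTop_nhds_zero_nat t)
      have h3 := (Complex.continuous_ofReal.tendsto 0).comp this
      simpa [Function.comp_def] using h3
    obtain ⟨n, hn, hn0⟩ := ((hlim.eventually (key ε hε)).and (eventually_gt_atTop 0)).exists
    have hn1 := hn (Complex.ofReal_im _)
    have hn0' : (n : ℝ) ≠ 0 := by positivity
    have e1 : (t : ℂ) = (n : ℂ) * ((t / n : ℝ) : ℂ) := by
      have : (n : ℂ) ≠ 0 := by exact_mod_cast hn0'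
      push_cast; field_simp
    rw [e1, exp_smul_natCast_mul]
    calc _ ≤ ‖NormedSpace.exp (((t / n : ℝ) : ℂ) • Z)‖ ^ n := norm_pow_le _ _
      _ ≤ (Real.exp (ε * ‖((t / n : ℝ) : ℂ)‖)) ^ n := by
        gcongr
        exact hn1.trans (by rw [add_comm]; exact Real.add_one_le_exp _)
      _ = _ := by
        rw [← Real.exp_nat_mul, Complex.norm_real, Real.norm_eq_abs, abs_div, Nat.abs_cast]
        congr 1; field_simp
  have hc : Tendsto (fun ε : ℝ => Real.exp (ε * |t|)) (𝓝[>] 0) (𝓝 1) := by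
    have : Continuous (fun ε : ℝ => Real.exp (ε * |t|)) := by fun_prop
    have h4 := this.tendsto 0
    simp only [zero_mul, Real.exp_zero] at h4
    exact h4.mono_left nhdsWithin_le_nhds
  exact ge_of_tendsto hc (by filter_upwards [self_mem_nhdsWithin] with ε hε using key2 ε hε)

/-- Gelfand's formula covers all large `n`; the constant absorbs the finitely many others. -/
theorem exists_norm_pow_le_of_spectralRadius_le_one {W : 𝒜} (hW : spectralRadius ℂ W ≤ 1)
    {δ : ℝ} (hδ : 0 < δ) : ∃ C : ℝ, ∀ n : ℕ, ‖W ^ n‖ ≤ C * (1 + δ) ^ n := by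
  have hlim := spectrum.pow_nnnorm_pow_one_div_tendsto_nhds_spectralRadius W
  have hlt : spectralRadius ℂ W < ENNReal.ofReal (1 + δ) :=
    hW.trans_lt (by rw [← ENNReal.ofReal_one]; exact (ENNReal.ofReal_lt_ofReal_iff (by linarith)).2 (by linarith))
  obtain ⟨N, hN⟩ := eventually_atTop.1 (hlim.eventually (gt_mem_nhds hlt))
  refine ⟨1 + ∑ n ∈ Finset.range (N + 1), ‖W ^ n‖, fun n => ?_⟩
  have hp : (1 : ℝ) ≤ (1 + δ) ^ n := one_le_pow₀ (by linarith)
  have hs : 0 ≤ ∑ n ∈ Finset.range (N + 1), ‖W ^ n‖ := Finset.sum_nonneg fun _ _ => norm_nonneg _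
  by_cases hn : n < N + 1
  · have := Finset.single_le_sum (f := fun n => ‖W ^ n‖) (fun _ _ => norm_nonneg _)
      (Finset.mem_range.2 hn)
    nlinarith
  · have hn0 : (n : ℝ) ≠ 0 := by
      have : n ≠ 0 := by omega
      exact_mod_cast this
    have h1 := (hN n (by omega)).le
    have h2 := ENNReal.rpow_le_rpow h1 (Nat.cast_nonneg n)
    rw [← ENNReal.rpow_mul, one_div, inv_mul_cancel₀ hn0, ENNReal.rpow_one, ENNReal.rpow_natCast,
      ← ENNReal.ofReal_pow (by linarith), ← enorm_eq_nnnorm, ← ofReal_norm] at h2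
    have h3 := (ENNReal.ofReal_le_ofReal_iff (by positivity)).1 h2
    nlinarith

/-- If the spectrum of `T` lies in `[0, ∞)`, then `exp (-xT)` grows subexponentially. -/
theorem exists_norm_exp_neg_le [NormOneClass 𝒜] {T : 𝒜}
    (hT : ∀ z ∈ spectrum ℂ T, 0 ≤ z.re ∧ z.im = 0) {ε : ℝ} (hε : 0 < ε) :
    ∃ C : ℝ, ∀ x : ℝ, 0 ≤ x → ‖NormedSpace.exp ((-x : ℂ) • T)‖ ≤ C * Real.exp (ε * x) := by
  -- This scaling puts the spectrum of `αT` in `[0,1]`, hence that of `W = 1 - αT` too. Then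
  -- `exp(-xT) = e^{-x/α} exp((x/α)W)`, and the powers of `W` grow at most like `(1+εα)^n`.
  set α : ℝ := (‖T‖ + 1)⁻¹ with hα
  have hα0 : 0 < α := by positivity
  have hα1 : α * (‖T‖ + 1) = 1 := inv_mul_cancel₀ (by positivity)
  set W : 𝒜 := 1 - (α : ℂ) • T with hWdef
  have hW : spectralRadius ℂ W ≤ 1 := by
    refine iSup₂_le fun z hz => ?_
    have hz' : (1 - z) / α ∈ spectrum ℂ T := by
      rw [spectrum.mem_iff] at hz ⊢
      contrapose! hz
      have hu : IsUnit ((-(α : ℂ)) • (algebraMap ℂ 𝒜 ((1 - z) / α) - T)) := by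
        have h0 : (-(α : ℂ)) ≠ 0 := by simpa using hα0.ne'
        exact (hz.smul (Units.mk0 _ h0))
      convert hu using 1
      have h0 : (α : ℂ) ≠ 0 := by simpa using hα0.ne'
      rw [hWdef, smul_sub, Algebra.algebraMap_eq_smul_one, Algebra.algebraMap_eq_smul_one, smul_smul,
        neg_mul, mul_div_cancel₀ _ h0]
      module
    obtain ⟨h1, h2⟩ := hT _ hz'
    have h3 : ‖(1 - z) / α‖ ≤ ‖T‖ := spectrum.norm_le_norm_of_mem hz'
    set k := (1 - z) / α with hk
    have h0 : (α : ℂ) ≠ 0 := by simpa using hα0.ne'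
    have hzk : z = ((1 - α * k.re : ℝ) : ℂ) := by
      have : k = (k.re : ℂ) := Complex.ext rfl (by simpa using h2)
      have h5 : z = 1 - α * k := by rw [hk]; field_simp; ring
      rw [h5]; nth_rewrite 1 [this]; push_cast; ring
    have h4 : k.re ≤ ‖T‖ := (Complex.re_le_norm k).trans h3
    have h6 : ‖z‖ ≤ 1 := by
      rw [hzk, Complex.norm_real, Real.norm_eq_abs, abs_le]
      constructor <;> nlinarith
    exact_mod_cast h6
  obtain ⟨C, hC⟩ := exists_norm_pow_le_of_spectralRadius_le_one hW (mul_pos hε hα0)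
  refine ⟨C, fun x hx => ?_⟩
  have e1 : (-x : ℂ) • T = ((-(x / α) : ℝ) : ℂ) • (1 : 𝒜) + ((x / α : ℝ) : ℂ) • W := by
    have h0 : (α : ℂ) ≠ 0 := by simpa using hα0.ne'
    rw [hWdef, smul_sub, smul_smul, ← Complex.ofReal_mul, div_mul_cancel₀ _ hα0.ne']
    push_cast; module
  have h1 := NormedSpace.exp_series_hasSum_exp' (𝕂 := ℂ) (((x / α : ℝ) : ℂ) • W)
  have h2 := (NormedSpace.exp_series_hasSum_exp' (𝕂 := ℝ) ((x / α) * (1 + ε * α))).mul_left C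
  rw [← Real.exp_eq_exp_ℝ] at h2
  have h3 := h1.norm_le_of_bounded h2 fun n => by
    rw [norm_smul, norm_inv, Complex.norm_natCast, smul_eq_mul, smul_pow, norm_smul, norm_pow,
      Complex.norm_real, Real.norm_of_nonneg (by positivity), mul_pow]
    calc _ ≤ ((n.factorial : ℝ))⁻¹ * ((x / α) ^ n * (C * (1 + ε * α) ^ n)) := by
          gcongr; exact hC n
      _ = _ := by ring
  rw [e1, commute_exp_add _ _ ((Commute.one_left _).smul_left _), ← Algebra.algebraMap_eq_smul_one,
    ← NormedSpace.algebraMap_exp_comm, ← Complex.exp_eq_exp_ℂ]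
  calc _ ≤ ‖algebraMap ℂ 𝒜 (Complex.exp ((-(x / α) : ℝ) : ℂ))‖ * _ := norm_mul_le _ _
    _ ≤ Real.exp (-(x / α)) * (C * Real.exp (x / α * (1 + ε * α))) := by
      gcongr
      rw [norm_algebraMap', ← Complex.ofReal_exp, Complex.norm_real, Real.norm_of_nonneg (Real.exp_nonneg _)]
    _ = C * (Real.exp (-(x / α)) * Real.exp (x / α * (1 + ε * α))) := by ring
    _ = _ := by
      rw [← Real.exp_add]; congr 2; field_simp; ring

/-- If `exp (itT)` is a contraction for real `t` and the spectrum of `T` lies in `[0, ∞)`,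
then `exp (-zT)` is a contraction for `Re z ≥ 0`. -/
theorem norm_exp_neg_le_one [NormOneClass 𝒜] {T : 𝒜}
    (hI : ∀ t : ℝ, ‖NormedSpace.exp ((t : ℂ) • (Complex.I • T))‖ ≤ 1)
    (hT : ∀ z ∈ spectrum ℂ T, 0 ≤ z.re ∧ z.im = 0) {z : ℂ} (hz : 0 ≤ z.re) :
    ‖NormedSpace.exp ((-z) • T)‖ ≤ 1 := by
  -- The factor `e^{-εz}` supplies the decay along the positive axis that Phragmén–Lindelöf needs;
  -- it is removed by `ε → 0`.
  have key : ∀ ε : ℝ, 0 < ε →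
      ‖Complex.exp (-ε * z) • NormedSpace.exp ((-z) • T)‖ ≤ 1 := by
    intro ε hε
    have hd : Differentiable ℂ fun w : ℂ => Complex.exp (-ε * w) • NormedSpace.exp ((-w) • T) := by
      refine Differentiable.smul (Complex.differentiable_exp.comp
        (differentiable_id.const_mul _)) fun w => ?_
      exact ((hasDerivAt_exp_smul_const (𝕂 := ℂ) T (-w)).scomp w
        (hasDerivAt_neg w)).differentiableAt
    have hn : ∀ w : ℂ, ‖Complex.exp (-ε * w)‖ = Real.exp (-ε * w.re) := by
      intro w
      rw [Complex.norm_exp]; simp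
    refine PhragmenLindelof.right_half_plane_of_tendsto_zero_on_real
      (f := fun w : ℂ => Complex.exp (-ε * w) • NormedSpace.exp ((-w) • T)) hd.diffContOnCl
      ⟨1, by norm_num, ε + ‖T‖, ?_⟩ ?_ ?_ hz
    · refine Asymptotics.IsBigO.of_bound 1 (Eventually.of_forall fun w => ?_)
      rw [norm_smul, hn, one_mul, Real.norm_of_nonneg (Real.exp_nonneg _), Real.rpow_one, add_mul,
        Real.exp_add]
      refine mul_le_mul (Real.exp_le_exp.2 ?_) (by simpa using norm_exp_smul_le T (-w))
        (norm_nonneg _) (Real.exp_nonneg _)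
      nlinarith [neg_abs_le w.re, Complex.abs_re_le_norm w]
    · obtain ⟨C, hC⟩ := exists_norm_exp_neg_le hT (half_pos hε)
      have hlim : Tendsto (fun x : ℝ => C * Real.exp (-(ε / 2 * x))) atTop (𝓝 0) := by
        have h1 : Tendsto (fun x : ℝ => ε / 2 * x) atTop atTop :=
          tendsto_id.const_mul_atTop (half_pos hε)
        simpa using (Real.tendsto_exp_neg_atTop_nhds_zero.comp h1).const_mul C
      refine squeeze_zero_norm' ?_ hlim
      filter_upwards [eventually_ge_atTop 0] with x hx
      rw [norm_smul, hn, Complex.ofReal_re]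
      calc _ ≤ Real.exp (-ε * x) * (C * Real.exp (ε / 2 * x)) := by gcongr; exact hC x hx
        _ = C * (Real.exp (-ε * x) * Real.exp (ε / 2 * x)) := by ring
        _ = _ := by rw [← Real.exp_add]; congr 2; ring
    · intro x
      rw [norm_smul, hn]
      have := hI (-x)
      rw [smul_smul] at this
      simpa using this
  have hc : Tendsto (fun ε : ℝ => ‖Complex.exp (-ε * z) • NormedSpace.exp ((-z) • T)‖) (𝓝[>] 0)
      (𝓝 ‖NormedSpace.exp ((-z) • T)‖) := by
    have : Continuous (fun ε : ℝ => ‖Complex.exp (-ε * z) • NormedSpace.exp ((-z) • T)‖) := by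
      fun_prop
    have h4 := this.tendsto 0
    simp only [Complex.ofReal_zero, neg_zero, zero_mul, Complex.exp_zero, one_smul] at h4
    exact h4.mono_left nhdsWithin_le_nhds
  exact le_of_tendsto hc (by filter_upwards [self_mem_nhdsWithin] with ε hε using key ε hε)

/-- `1 - tT` differs by `o(t)` from the contraction `exp(-tT)`. -/
theorem norm_one_sub_smul_le [NormOneClass 𝒜] {T : 𝒜}
    (hI : ∀ t : ℝ, ‖NormedSpace.exp ((t : ℂ) • (Complex.I • T))‖ ≤ 1)
    (hT : ∀ z ∈ spectrum ℂ T, 0 ≤ z.re ∧ z.im = 0) {ε : ℝ} (hε : 0 < ε) :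
    ∃ t : ℝ, 0 < t ∧ ‖1 - (t : ℂ) • T‖ ≤ 1 + ε * t := by
  have h0 := (hasDerivAt_exp_smul_const (𝕂 := ℂ) T 0).isLittleO.bound hε
  have hlim : Tendsto (fun t : ℝ => (-t : ℂ)) (𝓝[>] 0) (𝓝 0) := by
    have : Continuous fun t : ℝ => (-t : ℂ) := by fun_prop
    have h1 := this.tendsto 0
    simp only [Complex.ofReal_zero, neg_zero] at h1
    exact h1.mono_left nhdsWithin_le_nhds
  obtain ⟨t, ht, ht0⟩ := ((hlim.eventually h0).and self_mem_nhdsWithin).exists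
  have ht0 : 0 < t := ht0
  refine ⟨t, ht0, ?_⟩
  simp only [zero_smul, NormedSpace.exp_zero, sub_zero, one_mul, norm_neg, Complex.norm_real,
    Real.norm_of_nonneg ht0.le] at ht
  calc ‖1 - (t : ℂ) • T‖
      = ‖NormedSpace.exp ((-t : ℂ) • T) - (NormedSpace.exp ((-t : ℂ) • T) - 1 - (-t : ℂ) • T)‖ := by
        congr 1; rw [neg_smul]; abel
    _ ≤ _ := norm_sub_le _ _
    _ ≤ _ := add_le_add (norm_exp_neg_le_one hI hT (by simpa using ht0.le)) ht

/-- The half-plane bound applies to both `T` and `-T`, so `exp(zT)` is a bounded entire function. It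
is constant by Liouville, and its derivative at `0` is `T`. -/
theorem eq_zero_of_spectrum_subset_zero [NormOneClass 𝒜] {T : 𝒜}
    (hI : ∀ t : ℝ, ‖NormedSpace.exp ((t : ℂ) • (Complex.I • T))‖ ≤ 1)
    (hT : ∀ z ∈ spectrum ℂ T, z = 0) : T = 0 := by
  have h1 : ∀ z : ℂ, ‖NormedSpace.exp (z • T)‖ ≤ 1 := by
    intro z
    rcases le_total z.re 0 with hz | hz
    · simpa using norm_exp_neg_le_one hI (fun w hw => by simp [hT w hw]) (z := -z) (by simpa using hz)
    · have hI' : ∀ t : ℝ, ‖NormedSpace.exp ((t : ℂ) • (Complex.I • (-T)))‖ ≤ 1 := fun t => by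
        simpa using hI (-t)
      have hT' : ∀ w ∈ spectrum ℂ (-T), 0 ≤ w.re ∧ w.im = 0 := fun w hw => by
        rw [← spectrum.neg_eq] at hw
        have := hT _ hw
        simp [neg_eq_zero.1 this]
      simpa using norm_exp_neg_le_one hI' hT' hz
  have hd : Differentiable ℂ fun w : ℂ => NormedSpace.exp (w • T) := fun w =>
    (hasDerivAt_exp_smul_const (𝕂 := ℂ) T w).differentiableAt
  have hc := hd.apply_eq_apply_of_bounded
    ((Metric.isBounded_closedBall (x := (0 : 𝒜)) (r := 1)).subset (by
      rintro _ ⟨w, rfl⟩; simpa using h1 w))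
  have h2 := hasDerivAt_exp_smul_const (𝕂 := ℂ) T 0
  have h3 : (fun w : ℂ => NormedSpace.exp (w • T)) = fun _ => NormedSpace.exp ((0 : ℂ) • T) :=
    funext fun w => hc w 0
  rw [h3] at h2
  simpa using (h2.unique (hasDerivAt_const _ _))

end BanachAlgebra

/-! ### Hermitian operators. -/

section Hermitian

variable {E : Type*} [NormedAddCommGroup E] [NormedSpace ℂ E]

/-- If `f` norms `S`, then `B ↦ f(BS)/‖S‖` is a state, hence real at `T`. The perturbation therefore
changes only the imaginary part of `f(S) = ‖S‖`. -/
theorem IsHermitianOp.norm_le_norm_sub {T : E →L[ℂ] E} (hT : IsHermitianOp T) (t : ℝ)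
    (S : E →L[ℂ] E) : ‖S‖ ≤ ‖S - (t : ℂ) • ((Complex.I • T) * S)‖ := by
  rcases eq_or_ne ‖S‖ 0 with hS | hS
  · rw [hS]; positivity
  obtain ⟨f, hf1, hfS⟩ := exists_dual_vector ℂ S hS
  set g : (E →L[ℂ] E) →L[ℂ] ℂ :=
    ((‖S‖ : ℂ)⁻¹) • f.comp ((ContinuousLinearMap.mul ℂ (E →L[ℂ] E)).flip S) with hg
  have hgB : ∀ B, g B = (‖S‖ : ℂ)⁻¹ * f (B * S) := fun B => rfl
  have hSc : (‖S‖ : ℂ) ≠ 0 := by exact_mod_cast hS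
  have hmem : g ∈ stateSet (E →L[ℂ] E) (ContinuousLinearMap.id ℂ E) := by
    refine ⟨ContinuousLinearMap.opNorm_le_bound _ zero_le_one fun B => ?_, ?_⟩
    · rw [hgB, norm_mul, norm_inv, Complex.norm_real, norm_norm, one_mul]
      calc ‖S‖⁻¹ * ‖f (B * S)‖ ≤ ‖S‖⁻¹ * (1 * (‖B‖ * ‖S‖)) := by
            gcongr
            exact (f.le_opNorm _).trans (by rw [hf1]; gcongr; exact norm_mul_le _ _)
        _ = ‖B‖ := by field_simp
    · rw [hgB]
      have : (ContinuousLinearMap.id ℂ E) * S = S := one_mul S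
      rw [this, hfS]
      exact inv_mul_cancel₀ hSc
  have him := hT _ ⟨g, hmem, rfl⟩
  simp only at him
  have hfT : f (T * S) = ‖S‖ * ((g T).re : ℂ) := by
    have : g T = ((g T).re : ℂ) := Complex.ext rfl (by simpa using him)
    rw [← this, hgB, ← mul_assoc, mul_inv_cancel₀ hSc, one_mul]
  have hval : f (S - (t : ℂ) • ((Complex.I • T) * S)) =
      ‖S‖ - t * (Complex.I * (‖S‖ * ((g T).re : ℂ))) := by
    rw [map_sub, map_smul, smul_mul_assoc, map_smul, hfS, hfT]; rfl
  have hle := f.le_opNorm (S - (t : ℂ) • ((Complex.I • T) * S))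
  rw [hf1, one_mul] at hle
  refine le_trans ?_ hle
  refine le_trans ?_ (Complex.re_le_norm _)
  rw [hval]
  simp

variable [CompleteSpace E]

theorem IsHermitianOp.norm_exp_le_one [Nontrivial E] {T : E →L[ℂ] E} (hT : IsHermitianOp T)
    (t : ℝ) : ‖NormedSpace.exp ((t : ℂ) • (Complex.I • T))‖ ≤ 1 :=
  norm_exp_le_one_of_norm_le_norm_sub hT.norm_le_norm_sub t

/-- A hermitian operator with non-negative spectrum has non-negative numerical range. -/
theorem IsHermitianOp.exists_norm_one_sub_smul_le {T : E →L[ℂ] E} (hT : IsHermitianOp T)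
    (hs : ∀ z ∈ spectrum ℂ T, 0 ≤ z.re ∧ z.im = 0) {ε : ℝ} (hε : 0 < ε) :
    ∃ t : ℝ, 0 < t ∧ ‖1 - (t : ℂ) • T‖ ≤ 1 + ε * t := by
  rcases subsingleton_or_nontrivial E with h | h
  · refine ⟨1, one_pos, ?_⟩
    rw [Subsingleton.elim (1 - ((1 : ℝ) : ℂ) • T) 0, norm_zero]
    positivity
  · exact norm_one_sub_smul_le hT.norm_exp_le_one hs hε

/-- A quasinilpotent hermitian operator vanishes. -/
theorem IsHermitianOp.eq_zero {T : E →L[ℂ] E} (hT : IsHermitianOp T)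
    (hs : ∀ z ∈ spectrum ℂ T, z = 0) : T = 0 := by
  rcases subsingleton_or_nontrivial E with h | h
  · exact Subsingleton.elim _ _
  · exact eq_zero_of_spectrum_subset_zero hT.norm_exp_le_one hs

end Hermitian

namespace JBStarTriple

/-! ### Continuity of the triple product. -/

section Bound

variable {E : Type*} [NormedAddCommGroup E] [NormedSpace ℂ E] [CompleteSpace E] [JBStarTriple E]

/-- Polarization over the fourth roots of unity: only the term with a single `b`, in the
conjugate-linear slot, survives. It transfers the norm axiom from cubes to `{x,b,x}`. -/
theorem four_smul_triple (x b : E) :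
    (4 : ℂ) • triple x b x = triple (x + b) (x + b) (x + b) - triple (x - b) (x - b) (x - b)
      + Complex.I • triple (x + Complex.I • b) (x + Complex.I • b) (x + Complex.I • b)
      - Complex.I • triple (x - Complex.I • b) (x - Complex.I • b) (x - Complex.I • b) := by
  simp only [map_add, map_sub, map_smul, map_smulₛₗ, LinearMap.add_apply, LinearMap.sub_apply,
    LinearMap.smul_apply, Complex.conj_I]
  match_scalars <;> ring_nf <;> simp [Complex.I_sq]; norm_num

theorem norm_triple_self_le (x b : E) : ‖triple x b x‖ ≤ (‖x‖ + ‖b‖) ^ 3 := by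
  have h := congrArg norm (four_smul_triple x b)
  rw [norm_smul] at h
  have hq : ∀ y : E, ‖y‖ ≤ ‖x‖ + ‖b‖ → ‖triple y y y‖ ≤ (‖x‖ + ‖b‖) ^ 3 := fun y hy => by
    rw [norm_cube]; gcongr
  have hI : ‖Complex.I • b‖ = ‖b‖ := by rw [norm_smul, Complex.norm_I, one_mul]
  have h1 := hq _ (norm_add_le x b)
  have h2 := hq _ (norm_sub_le x b)
  have h3 := hq (x + Complex.I • b) ((norm_add_le _ _).trans_eq (by rw [hI]))
  have h4 := hq (x - Complex.I • b) ((norm_sub_le _ _).trans_eq (by rw [hI]))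
  have hs : ∀ y : E, ‖Complex.I • y‖ = ‖y‖ := fun y => by rw [norm_smul, Complex.norm_I, one_mul]
  have h5 : ‖(4 : ℂ)‖ * ‖triple x b x‖ ≤ 4 * (‖x‖ + ‖b‖) ^ 3 := by
    rw [h]
    refine (norm_sub_le _ _).trans ?_
    refine (add_le_add_left ((norm_add_le _ _).trans (add_le_add_left (norm_sub_le _ _) _)) _).trans ?_
    rw [hs, hs]
    linarith
  have h6 : ‖(4 : ℂ)‖ = 4 := by norm_num
  rw [h6] at h5
  linarith

theorem two_smul_triple (a b c : E) :
    (2 : ℂ) • triple a b c = triple (a + c) b (a + c) - triple a b a - triple c b c := by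
  simp only [map_add, LinearMap.add_apply, triple_symm c b a]
  module

/-- The triple product is bounded. -/
theorem norm_triple_le (a b c : E) : ‖triple a b c‖ ≤ 22 * ‖a‖ * ‖b‖ * ‖c‖ := by
  -- On the unit ball polarization gives `(27 + 8 + 8)/2 = 21.5`, rounded up to `22`.
  have key : ∀ a b c : E, ‖a‖ ≤ 1 → ‖b‖ ≤ 1 → ‖c‖ ≤ 1 → ‖triple a b c‖ ≤ 22 := by
    intro a b c ha hb hc
    have h := congrArg norm (two_smul_triple a b c)
    rw [norm_smul] at h
    have h1 : ‖triple (a + c) b (a + c)‖ ≤ 27 :=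
      (norm_triple_self_le _ _).trans (by
        have : ‖a + c‖ + ‖b‖ ≤ 3 := by linarith [norm_add_le a c]
        calc _ ≤ (3 : ℝ) ^ 3 := by gcongr
          _ = 27 := by norm_num)
    have h2 : ∀ y : E, ‖y‖ ≤ 1 → ‖triple y b y‖ ≤ 8 := fun y hy =>
      (norm_triple_self_le _ _).trans (by
        have : ‖y‖ + ‖b‖ ≤ 2 := by linarith
        calc _ ≤ (2 : ℝ) ^ 3 := by gcongr
          _ = 8 := by norm_num)
    have h3 := norm_sub_le (triple (a + c) b (a + c) - triple a b a) (triple c b c)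
    have h4 := norm_sub_le (triple (a + c) b (a + c)) (triple a b a)
    have h6 : ‖(2 : ℂ)‖ = 2 := by norm_num
    rw [h6] at h
    linarith [h2 a ha, h2 c hc]
  have hu : ∀ y : E, ∃ u : E, ‖u‖ ≤ 1 ∧ y = (‖y‖ : ℂ) • u := fun y => by
    rcases eq_or_ne y 0 with rfl | hy
    · exact ⟨0, by simp, by simp⟩
    · have hy' : (‖y‖ : ℂ) ≠ 0 := by simpa using hy
      refine ⟨(‖y‖ : ℂ)⁻¹ • y, ?_, by rw [smul_smul, mul_inv_cancel₀ hy', one_smul]⟩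
      rw [norm_smul, norm_inv, Complex.norm_real, norm_norm, inv_mul_cancel₀ (norm_ne_zero_iff.2 hy)]
  obtain ⟨u, hu1, hu2⟩ := hu a
  obtain ⟨v, hv1, hv2⟩ := hu b
  obtain ⟨w, hw1, hw2⟩ := hu c
  have h := key u v w hu1 hv1 hw1
  have e : ‖triple a b c‖ = ‖a‖ * (‖b‖ * (‖c‖ * ‖triple u v w‖)) := by
    conv_lhs => rw [hu2, hv2, hw2]
    simp only [map_smul, map_smulₛₗ, LinearMap.smul_apply, norm_smul, Complex.norm_real, norm_norm,
      RCLike.norm_conj]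
    ring
  rw [e]
  calc _ ≤ ‖a‖ * (‖b‖ * (‖c‖ * 22)) := by gcongr
    _ = _ := by ring

theorem continuous_triple : Continuous fun p : E × E × E => triple p.1 p.2.1 p.2.2 := by
  rw [continuous_iff_continuousAt]
  rintro ⟨a, b, c⟩
  rw [ContinuousAt, tendsto_iff_norm_sub_tendsto_zero]
  have hle : ∀ p : E × E × E, ‖triple p.1 p.2.1 p.2.2 - triple a b c‖ ≤
      22 * ‖p.1 - a‖ * ‖p.2.1‖ * ‖p.2.2‖ + 22 * ‖a‖ * ‖p.2.1 - b‖ * ‖p.2.2‖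
        + 22 * ‖a‖ * ‖b‖ * ‖p.2.2 - c‖ := by
    intro p
    have : triple p.1 p.2.1 p.2.2 - triple a b c = triple (p.1 - a) p.2.1 p.2.2 +
        triple a (p.2.1 - b) p.2.2 + triple a b (p.2.2 - c) := by
      simp only [map_sub, LinearMap.sub_apply]; abel
    rw [this]
    exact (norm_add₃_le).trans (add_le_add (add_le_add (norm_triple_le _ _ _)
      (norm_triple_le _ _ _)) (norm_triple_le _ _ _))
  refine squeeze_zero (fun _ => norm_nonneg _) hle ?_
  have hc : Continuous fun p : E × E × E => 22 * ‖p.1 - a‖ * ‖p.2.1‖ * ‖p.2.2‖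
      + 22 * ‖a‖ * ‖p.2.1 - b‖ * ‖p.2.2‖ + 22 * ‖a‖ * ‖b‖ * ‖p.2.2 - c‖ := by fun_prop
  simpa using hc.tendsto (a, b, c)

/-- The operator `L(a, b)` as a bounded operator. -/
noncomputable def boxOp (a b : E) : E →L[ℂ] E :=
  (triple a b).mkContinuous (22 * ‖a‖ * ‖b‖) (norm_triple_le a b)

@[simp] theorem boxOp_apply (a b x : E) : boxOp a b x = triple a b x := rfl

theorem isHermitianOp_boxOp (a : E) : IsHermitianOp (boxOp a a) := by
  obtain ⟨T, hT, h, -⟩ := hermitian_nonneg a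
  rwa [show boxOp a a = T from ContinuousLinearMap.ext fun x => (hT x).symm]

theorem spectrum_boxOp_nonneg (a : E) : ∀ z ∈ spectrum ℂ (boxOp a a), 0 ≤ z.re ∧ z.im = 0 := by
  obtain ⟨T, hT, -, h⟩ := hermitian_nonneg a
  rwa [show boxOp a a = T from ContinuousLinearMap.ext fun x => (hT x).symm]

theorem IsTripotent.norm_le_one {e : E} (he : IsTripotent e) : ‖e‖ ≤ 1 := by
  have h := norm_cube e
  rw [show triple e e e = e from he] at h
  by_contra! hc
  nlinarith [mul_pos (sub_pos.2 hc) (norm_nonneg e |>.lt_of_ne' (by positivity))]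

end Bound

/-! ### Peirce decomposition and multiplication rules. -/

section Peirce

variable {E : Type*} [NormedAddCommGroup E] [NormedSpace ℂ E] [CompleteSpace E] [JBStarTriple E]
  {e : E}

theorem mem_peirce_zero {x : E} : x ∈ peirce e 0 ↔ triple e e x = 0 := by
  rw [mem_peirce]; simp

theorem mem_peirce_one {x : E} : x ∈ peirce e 1 ↔ triple e e x = (1 / 2 : ℂ) • x := by
  rw [mem_peirce]; simp

theorem IsTripotent.box_quad_add (he : IsTripotent e) (x : E) :
    triple e e (triple e x e) = (2 : ℂ) • triple e x e - triple e (triple e e x) e := by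
  have h := jordan e e e x e
  rw [show triple e e e = e from he] at h
  rw [h]; module

/-- Write `D = L(e,e)` and `Qx = {e,x,e}`. Two instances of the Jordan identity give `DQ = 2Q - QD`
and `Q = 2DQ - QD`; eliminating `DQ` leaves `QD = Q`. -/
theorem IsTripotent.quad_box (he : IsTripotent e) (x : E) :
    triple e (triple e e x) e = triple e x e := by
  have h := jordan e x e e e
  rw [show triple e e e = e from he, triple_symm (triple e x e) e e, triple_symm x e e,
    he.box_quad_add] at h
  have h2 : (3 : ℂ) • (triple e (triple e e x) e - triple e x e) = 0 := by
    linear_combination (norm := module) (1 : ℂ) • h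
  exact sub_eq_zero.1 ((smul_eq_zero.1 h2).resolve_left (by norm_num))

theorem IsTripotent.box_quad (he : IsTripotent e) (x : E) :
    triple e e (triple e x e) = triple e x e := by
  rw [he.box_quad_add, he.quad_box]; module

theorem IsTripotent.quad_quad (he : IsTripotent e) (x : E) :
    triple e (triple e x e) e = (2 : ℂ) • triple e e (triple e e x) - triple e e x := by
  have h := jordan x e e e e
  rw [show triple e e e = e from he, triple_symm x e e,
    triple_symm (triple e e x) e e] at h
  linear_combination (norm := module) (1 : ℂ) • h

/-- Substitute `Q² = 2D² - D` into `DQ² = Q²`: thus `D(2D-1)(D-1) = 0`, and `0, 1/2, 1` are the only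
possible eigenvalues. -/
theorem IsTripotent.box_cubic (he : IsTripotent e) (x : E) :
    (2 : ℂ) • triple e e (triple e e (triple e e x)) =
      (3 : ℂ) • triple e e (triple e e x) - triple e e x := by
  have h := he.box_quad (triple e x e)
  rw [he.quad_quad, map_sub, map_smul] at h
  linear_combination (norm := module) (1 : ℂ) • h

theorem IsTripotent.exists_peirce_add (he : IsTripotent e) (x : E) :
    ∃ x₀ ∈ peirce e 0, ∃ x₁ ∈ peirce e 1, ∃ x₂ ∈ peirce e 2, x = x₀ + x₁ + x₂ := by
  have h := he.box_cubic x
  set D := triple e e x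
  set D2 := triple e e D
  -- The Lagrange interpolation polynomials in `D` at the nodes `0`, `1/2`, `1`.
  refine ⟨(2 : ℂ) • D2 - (3 : ℂ) • D + x, ?_, (4 : ℂ) • D - (4 : ℂ) • D2, ?_, (2 : ℂ) • D2 - D, ?_,
    by module⟩
  · rw [mem_peirce_zero]
    simp only [map_add, map_sub, map_smul]
    linear_combination (norm := module) (1 : ℂ) • h
  · rw [mem_peirce_one]
    simp only [map_sub, map_smul]
    linear_combination (norm := module) (-2 : ℂ) • h
  · rw [mem_peirce_two]
    simp only [map_sub, map_smul]
    linear_combination (norm := module) (1 : ℂ) • h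

/-- The product would have `L(e,e)`-eigenvalue `1 - 1/2 + 1 = 3/2`, which is not a root of the
cubic. -/
theorem IsTripotent.triple_one_two (he : IsTripotent e) {a c : E} (ha : a ∈ peirce e 1)
    (hc : c ∈ peirce e 2) : triple e a c = 0 := by
  rw [mem_peirce_one] at ha
  rw [mem_peirce_two] at hc
  have h := jordan e e e a c
  rw [show triple e e e = e from he, ha, hc, map_smulₛₗ, LinearMap.smul_apply] at h
  have h1 : triple e e (triple e a c) = (3 / 2 : ℂ) • triple e a c := by
    rw [h]
    simp only [map_div₀, map_one, Complex.conj_ofNat]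
    module
  have h2 := he.box_cubic (triple e a c)
  simp only [h1, map_smul] at h2
  have h3 : (3 / 2 : ℂ) • triple e a c = 0 := by
    linear_combination (norm := module) (1 : ℂ) • h2
  exact (smul_eq_zero.1 h3).resolve_left (by norm_num)

theorem IsTripotent.triple_one_zero_mem (he : IsTripotent e) {a w : E} (ha : a ∈ peirce e 1)
    (hw : w ∈ peirce e 0) : triple e a w ∈ peirce e 1 := by
  rw [mem_peirce_one] at ha ⊢
  rw [mem_peirce_zero] at hw
  rw [jordan, show triple e e e = e from he, ha, hw, map_smulₛₗ, LinearMap.smul_apply]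
  simp only [map_div₀, map_one, Complex.conj_ofNat, map_zero]
  module

theorem IsTripotent.triple_one_tripotent_one_mem (he : IsTripotent e) {a b : E}
    (ha : a ∈ peirce e 1) (hb : b ∈ peirce e 1) : triple a e b ∈ peirce e 0 := by
  rw [mem_peirce_one] at ha hb
  rw [mem_peirce_zero, jordan, show triple e e e = e from he, ha, hb, map_smul, map_smul,
    LinearMap.smul_apply, LinearMap.smul_apply]
  module

/-- Here the eigenvalue would be `1/2 - 1 + 0 = -1/2`, again not a root. -/
theorem IsTripotent.triple_one_tripotent_zero (he : IsTripotent e) {a w : E}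
    (ha : a ∈ peirce e 1) (hw : w ∈ peirce e 0) : triple a e w = 0 := by
  rw [mem_peirce_one] at ha
  rw [mem_peirce_zero] at hw
  have h := jordan e e a e w
  rw [show triple e e e = e from he, ha, hw, map_smul, map_zero, LinearMap.smul_apply,
    LinearMap.smul_apply] at h
  have h1 : triple e e (triple a e w) = (-1 / 2 : ℂ) • triple a e w := by
    rw [h]; module
  have h2 := he.box_cubic (triple a e w)
  simp only [h1, map_smul] at h2
  have h3 : (-3 / 2 : ℂ) • triple a e w = 0 := by
    linear_combination (norm := module) (1 : ℂ) • h2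
  exact (smul_eq_zero.1 h3).resolve_left (by norm_num)

theorem IsTripotent.quad_triple_one_one (he : IsTripotent e) {a b : E} (ha : a ∈ peirce e 1)
    (hb : b ∈ peirce e 1) : triple e (triple a b e) e = triple b a e := by
  have h2 := mem_peirce_two.1 (triple_mem_of_one_one he hb ha)
  have h := jordan b a e e e
  rw [show triple e e e = e from he, triple_symm (triple b a e) e e, h2] at h
  linear_combination (norm := module) (1 : ℂ) • h

end Peirce

end JBStarTriple

namespace JBStarTriple

/-! ### The commutative C*-algebra generated by a self-adjoint element of `E_2(e)`. -/

section JordanPowers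

variable {E : Type*} [NormedAddCommGroup E] [NormedSpace ℂ E] [CompleteSpace E] [JBStarTriple E]
  {e x y z : E}

/-- `x` is a self-adjoint element of the JB*-algebra `E_2(e)` of the tripotent `e`. -/
structure IsSelfAdjointTwo (e x : E) : Prop where
  tripotent : IsTripotent e
  mem : x ∈ peirce e 2
  star_eq : triple e x e = x

theorem IsTripotent.mem_two (he : IsTripotent e) : e ∈ peirce e 2 := mem_peirce_two.2 he

theorem IsTripotent.mul_mem_two (he : IsTripotent e) (hy : y ∈ peirce e 2) (hz : z ∈ peirce e 2) :
    triple y e z ∈ peirce e 2 :=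
  triple_mem_of_two_two hy he.mem_two hz

theorem IsTripotent.star_mem_two (he : IsTripotent e) (hy : y ∈ peirce e 2) :
    triple e y e ∈ peirce e 2 :=
  triple_mem_of_two_two he.mem_two hy he.mem_two

theorem IsTripotent.triple_left (he : IsTripotent e) (hy : y ∈ peirce e 2) (hz : z ∈ peirce e 2) :
    triple e y z = triple (triple e y e) e z := by
  have hy' : triple e e y = y := mem_peirce_two.1 hy
  have hs := he.star_mem_two hy
  have hss : triple e (triple e y e) e = y := by
    rw [he.quad_quad, hy', hy']; module
  have h := jordan (triple e y e) e e e z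
  rw [mem_peirce_two.1 hz, triple_symm _ e e, mem_peirce_two.1 hs, hss,
    mem_peirce_two.1 (he.mul_mem_two hs hz)] at h
  linear_combination (norm := module) (1 : ℂ) • h

theorem IsTripotent.star_star (he : IsTripotent e) (hy : y ∈ peirce e 2) :
    triple e (triple e y e) e = y := by
  rw [he.quad_quad, mem_peirce_two.1 hy, mem_peirce_two.1 hy]; module

theorem IsTripotent.star_mul (he : IsTripotent e) (hy : y ∈ peirce e 2) (hz : z ∈ peirce e 2) :
    triple e (triple y e z) e = triple (triple e y e) e (triple e z e) := by
  have hys := he.star_mem_two hy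
  have h := jordan (triple e y e) e e z e
  rw [triple_symm _ e e, mem_peirce_two.1 hys, he.triple_left hys hz, he.star_star hy,
    triple_symm (triple e y e) z e, he.triple_left hz hys,
    triple_symm (triple e z e) e (triple e y e)] at h
  linear_combination (norm := module) (1 : ℂ) • h

/-- The triple product of `E_2(e)` in terms of the Jordan product and the involution. -/
theorem IsTripotent.triple_eq (he : IsTripotent e) {a b c : E} (ha : a ∈ peirce e 2)
    (hb : b ∈ peirce e 2) (hc : c ∈ peirce e 2) :
    triple a b c = triple a e (triple (triple e b e) e c) + triple (triple a e (triple e b e)) e c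
      - triple (triple e b e) e (triple a e c) := by
  have has := he.star_mem_two ha
  have h := jordan a e e b c
  rw [triple_symm a e e, mem_peirce_two.1 ha, he.triple_left hb hc,
    he.triple_left hb (he.mul_mem_two ha hc), he.triple_left ha hb,
    he.triple_left (he.mul_mem_two has hb) hc, he.star_mul has hb, he.star_star ha] at h
  linear_combination (norm := module) (-1 : ℂ) • h

/-- The powers of `x` in the Jordan algebra `E_2(e)`. -/
noncomputable def jpow (e x : E) : ℕ → E
  | 0 => e
  | n + 1 => triple x e (jpow e x n)

namespace IsSelfAdjointTwo

theorem jpow_mem (h : IsSelfAdjointTwo e x) (n : ℕ) : jpow e x n ∈ peirce e 2 := by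
  induction n with
  | zero => exact h.tripotent.mem_two
  | succ n ih => exact h.tripotent.mul_mem_two h.mem ih

theorem jpow_one (h : IsSelfAdjointTwo e x) : jpow e x 1 = x := by
  rw [jpow, jpow, triple_symm, mem_peirce_two.1 h.mem]

theorem triple_left (h : IsSelfAdjointTwo e x) (hz : z ∈ peirce e 2) :
    triple e x z = triple x e z := by
  rw [h.tripotent.triple_left h.mem hz, h.star_eq]

theorem jpow_star (h : IsSelfAdjointTwo e x) (n : ℕ) :
    triple e (jpow e x n) e = jpow e x n := by
  induction n with
  | zero => exact h.tripotent
  | succ n ih => rw [jpow, h.tripotent.star_mul h.mem (h.jpow_mem n), ih, h.star_eq]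

/-- Power associativity, obtained by showing that `δ`, the commutator of `L(x,e)` and `L(xⁿ,e)` at
`z`, vanishes. Moving one factor `x` from the middle slot to the left adds `δ`, so `L(xⁱ,xʲ) =
L(e,xⁿ⁺¹) + iδ` at `z`. The Jordan identity also gives `L(x,xⁿ) = L(xⁿ⁺¹,e) + δ`; comparing with `i
= 1` and `i = n + 1` gives `(n+1)δ = 0`. -/
theorem jpow_jpow (h : IsSelfAdjointTwo e x) (n : ℕ) : ∀ i j : ℕ, i + j = n → ∀ z ∈ peirce e 2,
    triple (jpow e x i) (jpow e x j) z = triple (jpow e x n) e z := by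
  induction n with
  | zero =>
    intro i j hij z _
    obtain ⟨rfl, rfl⟩ : i = 0 ∧ j = 0 := by omega
    rfl
  | succ n ih =>
    intro i j hij z hz
    set δ := triple x e (triple (jpow e x n) e z) - triple (jpow e x n) e (triple x e z) with hδ
    have hxz := h.tripotent.mul_mem_two h.mem hz
    have step : ∀ i j : ℕ, i + j = n → triple (jpow e x (i + 1)) (jpow e x j) z =
        triple (jpow e x i) (jpow e x (j + 1)) z + δ := by
      intro i j hij
      have h1 := jordan x e (jpow e x i) (jpow e x j) z
      rw [ih i j hij z hz, ih i j hij _ hxz, h.triple_left (h.jpow_mem j)] at h1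
      rw [hδ, jpow, jpow]
      linear_combination (norm := module) (-1 : ℂ) • h1
    have prog : ∀ i j : ℕ, i + j = n + 1 → triple (jpow e x i) (jpow e x j) z =
        triple e (jpow e x (n + 1)) z + (i : ℂ) • δ := by
      intro i
      induction i with
      | zero =>
        intro j hj
        obtain rfl : j = n + 1 := by omega
        simp [jpow]
      | succ i ihi =>
        intro j hj
        rw [step i j (by omega), ihi (j + 1) (by omega)]
        push_cast
        module
    have comm := jordan (jpow e x n) e x e z
    rw [h.jpow_star, triple_symm (jpow e x n) e x] at comm
    have h1 := prog 1 n (by omega)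
    have h2 := prog (n + 1) 0 (by omega)
    rw [h.jpow_one] at h1
    have hn : ((n : ℂ) + 1) • δ = 0 := by
      rw [show jpow e x (n + 1) = triple x e (jpow e x n) from rfl,
        show jpow e x 0 = e from rfl] at h2
      rw [show jpow e x (n + 1) = triple x e (jpow e x n) from rfl] at h1
      push_cast at h1 h2
      linear_combination (norm := module) (-1 : ℂ) • h2 + (1 : ℂ) • h1 + (-1 : ℂ) • comm
    have hδ0 : δ = 0 := (smul_eq_zero.1 hn).resolve_left (by exact_mod_cast n.succ_ne_zero)
    have h3 := prog i j hij
    have h4 := prog (n + 1) 0 (by omega)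
    rw [hδ0, smul_zero, add_zero] at h3 h4
    rw [h3, ← h4]
    rfl

theorem jpow_mul (h : IsSelfAdjointTwo e x) (i j : ℕ) :
    triple (jpow e x i) e (jpow e x j) = jpow e x (i + j) := by
  have h1 := h.jpow_jpow (i + j) i j rfl e h.tripotent.mem_two
  rw [triple_symm _ _ e, h.tripotent.triple_left (h.jpow_mem j) (h.jpow_mem i), h.jpow_star,
    triple_symm _ e e, mem_peirce_two.1 (h.jpow_mem _)] at h1
  rw [triple_symm, h1]

end IsSelfAdjointTwo

/-- The closed subspace of `E_2(e)` generated by the powers of `x`. -/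
noncomputable def powerAlgebra (e x : E) : Submodule ℂ E :=
  (Submodule.span ℂ (Set.range (jpow e x))).topologicalClosure

theorem isClosed_powerAlgebra : IsClosed (powerAlgebra e x : Set E) :=
  Submodule.isClosed_topologicalClosure _

instance : CompleteSpace (powerAlgebra e x) :=
  (isClosed_powerAlgebra (e := e) (x := x)).completeSpace_coe

theorem jpow_mem_powerAlgebra (n : ℕ) : jpow e x n ∈ powerAlgebra e x :=
  Submodule.le_topologicalClosure _ (Submodule.subset_span ⟨n, rfl⟩)

theorem powerAlgebra_le {N : Submodule ℂ E} (hN : IsClosed (N : Set E))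
    (h : ∀ n, jpow e x n ∈ N) : powerAlgebra e x ≤ N :=
  Submodule.topologicalClosure_minimal _
    (Submodule.span_le.2 (by rintro _ ⟨n, rfl⟩; exact h n)) hN

theorem eqOn_powerAlgebra {f g : E →L[ℂ] E} (h : ∀ n, f (jpow e x n) = g (jpow e x n))
    {a : E} (ha : a ∈ powerAlgebra e x) : f a = g a := by
  have h1 := powerAlgebra_le (N := LinearMap.ker (f - g).toLinearMap) (f - g).isClosed_ker
    (fun n => by simp [h n]) ha
  simpa [sub_eq_zero] using h1

namespace IsSelfAdjointTwo

variable {a b c : E}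

theorem powerAlgebra_le_peirce (h : IsSelfAdjointTwo e x) : powerAlgebra e x ≤ peirce e 2 :=
  fun _ ha => mem_peirce_two.2 (eqOn_powerAlgebra (f := boxOp e e) (g := .id ℂ E)
    (fun n => mem_peirce_two.1 (h.jpow_mem n)) ha)

theorem mul_mem (h : IsSelfAdjointTwo e x) (ha : a ∈ powerAlgebra e x)
    (hb : b ∈ powerAlgebra e x) : triple a e b ∈ powerAlgebra e x := by
  have hcl : ∀ y : E, IsClosed (((powerAlgebra e x).comap (boxOp y e).toLinearMap) : Set E) :=
    fun y => isClosed_powerAlgebra.preimage (boxOp y e).continuous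
  have h1 : ∀ n, triple (jpow e x n) e b ∈ powerAlgebra e x := fun n =>
    powerAlgebra_le (hcl (jpow e x n)) (fun m => by
      change triple (jpow e x n) e (jpow e x m) ∈ powerAlgebra e x
      rw [h.jpow_mul]; exact jpow_mem_powerAlgebra _) hb
  have h2 := powerAlgebra_le (hcl b) (fun m => by
      change triple b e (jpow e x m) ∈ powerAlgebra e x
      rw [triple_symm]; exact h1 m) ha
  rw [triple_symm]
  exact h2

theorem star_mem (h : IsSelfAdjointTwo e x) (ha : a ∈ powerAlgebra e x) :
    triple e a e ∈ powerAlgebra e x := by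
  have hc : Continuous fun y : E => triple e y e :=
    continuous_triple.comp (by fun_prop : Continuous fun y : E => (e, y, e))
  exact powerAlgebra_le (N := (powerAlgebra e x).comap ((triple e).flip e))
    (isClosed_powerAlgebra.preimage hc) (fun n => by
      change triple e (jpow e x n) e ∈ powerAlgebra e x
      rw [h.jpow_star]; exact jpow_mem_powerAlgebra _) ha

theorem mul_assoc (h : IsSelfAdjointTwo e x) (ha : a ∈ powerAlgebra e x)
    (hb : b ∈ powerAlgebra e x) (hc : c ∈ powerAlgebra e x) :
    triple (triple a e b) e c = triple a e (triple b e c) := by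
  have h1 : ∀ i j, triple (triple (jpow e x i) e (jpow e x j)) e c =
      triple (jpow e x i) e (triple (jpow e x j) e c) := fun i j =>
    eqOn_powerAlgebra (f := boxOp (triple (jpow e x i) e (jpow e x j)) e)
      (g := (boxOp (jpow e x i) e).comp (boxOp (jpow e x j) e))
      (fun k => by simp [h.jpow_mul, add_assoc]) hc
  have h2 : ∀ i, triple (triple (jpow e x i) e b) e c = triple (jpow e x i) e (triple b e c) := by
    intro i
    rw [triple_symm _ e c, triple_symm b e c]
    refine eqOn_powerAlgebra (f := (boxOp c e).comp (boxOp (jpow e x i) e))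
      (g := (boxOp (jpow e x i) e).comp (boxOp c e)) (fun j => ?_) hb
    have := h1 i j
    rw [triple_symm _ e c, triple_symm (jpow e x j) e c] at this
    exact this
  rw [triple_symm _ e c, triple_symm a e b, triple_symm a]
  refine eqOn_powerAlgebra (f := (boxOp c e).comp (boxOp b e))
      (g := boxOp (triple b e c) e) (fun i => ?_) ha
  have := h2 i
  rw [triple_symm _ e c, triple_symm _ e b, triple_symm (jpow e x i)] at this
  exact this

/-- The powers of a self-adjoint `x` in `E_2(e)` generate an associative commutative ring. -/
@[reducible]
noncomputable def commRing (h : IsSelfAdjointTwo e x) : CommRing (powerAlgebra e x) :=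
  { (inferInstance : AddCommGroup (powerAlgebra e x)) with
    mul := fun a b => ⟨triple (a : E) e b, h.mul_mem a.2 b.2⟩
    one := ⟨e, jpow_mem_powerAlgebra 0⟩
    mul_assoc := fun a b c => Subtype.ext (h.mul_assoc a.2 b.2 c.2)
    one_mul := fun a => Subtype.ext (mem_peirce_two.1 (h.powerAlgebra_le_peirce a.2))
    mul_one := fun a => Subtype.ext
      ((triple_symm _ _ _).trans (mem_peirce_two.1 (h.powerAlgebra_le_peirce a.2)))
    mul_comm := fun a b => Subtype.ext (triple_symm _ _ _)
    zero_mul := fun a => Subtype.ext (by change triple (0 : E) e (a : E) = 0; simp)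
    mul_zero := fun a => Subtype.ext (by change triple (a : E) e (0 : E) = 0; simp)
    left_distrib := fun a b c => Subtype.ext (map_add (triple (a : E) e) (b : E) (c : E))
    right_distrib := fun a b c => Subtype.ext (by
      change triple ((a : E) + b) e (c : E) = triple (a : E) e c + triple (b : E) e c
      simp) }

@[reducible]
noncomputable def starRing (h : IsSelfAdjointTwo e x) :
    letI := h.commRing; StarRing (powerAlgebra e x) :=
  letI := h.commRing
  { star := fun a => ⟨triple e (a : E) e, h.star_mem a.2⟩
    star_involutive := fun a => Subtype.ext (h.tripotent.star_star (h.powerAlgebra_le_peirce a.2))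
    star_mul := fun a b => Subtype.ext
      ((h.tripotent.star_mul (h.powerAlgebra_le_peirce a.2) (h.powerAlgebra_le_peirce b.2)).trans
        (triple_symm _ _ _))
    star_add := fun a b => Subtype.ext (by
      change triple e ((a : E) + b) e = triple e (a : E) e + triple e (b : E) e
      simp) }

/-- This turns the norm axiom into `‖aa*a‖ = ‖a‖³`, the source of both C*-norm properties. -/
theorem coe_mul_star_mul (h : IsSelfAdjointTwo e x) (a b c : powerAlgebra e x) :
    letI := h.commRing; letI := h.starRing
    ((a * star b * c : powerAlgebra e x) : E) = triple (a : E) (b : E) (c : E) := by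
  let _ := h.commRing
  let _ := h.starRing
  have hle := h.powerAlgebra_le_peirce
  rw [h.tripotent.triple_eq (hle a.2) (hle b.2) (hle c.2)]
  have h1 : a * star b * c = a * (star b * c) + (a * star b) * c - star b * (a * c) := by ring
  rw [h1]
  rfl

/-- Continuity gives `‖ab‖ ≤ 22‖a‖‖b‖`. Replacing `a, b` by `aa*a, bb*b` cubes both norms but keeps
the constant, so iteration improves it to `1`. -/
theorem norm_mul_le (h : IsSelfAdjointTwo e x) (a b : powerAlgebra e x) :
    letI := h.commRing
    ‖a * b‖ ≤ ‖a‖ * ‖b‖ := by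
  let _ := h.commRing
  let _ := h.starRing
  have hcube : ∀ a : powerAlgebra e x, ‖a * star a * a‖ = ‖a‖ ^ 3 := fun a => by
    change ‖((a * star a * a : powerAlgebra e x) : E)‖ = ‖(a : E)‖ ^ 3
    rw [h.coe_mul_star_mul, norm_cube]
  have key : ∀ (k : ℕ) (a b : powerAlgebra e x),
      ‖a * b‖ ^ 3 ^ k ≤ 22 * (‖a‖ * ‖b‖) ^ 3 ^ k := by
    intro k
    induction k with
    | zero =>
      intro a b
      have h1 := norm_triple_le (a : E) e (b : E)
      have h2 := h.tripotent.norm_le_one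
      simp only [pow_zero, pow_one]
      calc ‖a * b‖ ≤ 22 * ‖(a : E)‖ * ‖e‖ * ‖(b : E)‖ := h1
        _ ≤ 22 * ‖(a : E)‖ * 1 * ‖(b : E)‖ := by gcongr
        _ = _ := by rw [mul_one, _root_.mul_assoc]; rfl
    | succ k ih =>
      intro a b
      have h1 := ih (a * star a * a) (b * star b * b)
      have h2 : a * star a * a * (b * star b * b) = (a * b) * star (a * b) * (a * b) := by
        rw [StarMul.star_mul]; ring
      rw [h2, hcube, hcube, hcube, ← mul_pow, ← pow_mul, ← pow_mul] at h1
      rw [pow_succ']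
      exact h1
  by_contra! hlt
  have hs : 0 ≤ ‖a‖ * ‖b‖ := by positivity
  rcases hs.eq_or_lt with h0 | hpos
  · have := key 0 a b
    rw [← h0] at this hlt
    simp only [pow_zero, pow_one] at this
    linarith
  · have hr : 1 < ‖a * b‖ / (‖a‖ * ‖b‖) := (one_lt_div hpos).2 hlt
    obtain ⟨n, hn⟩ := pow_unbounded_of_one_lt 22 hr
    have h1 : n ≤ 3 ^ n := (Nat.lt_pow_self (by norm_num)).le
    have h2 := (pow_le_pow_right₀ hr.le h1).trans_lt' hn
    rw [div_pow, lt_div_iff₀ (by positivity)] at h2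
    exact absurd (key n a b) (not_le.2 h2)

/-- The powers of a self-adjoint `x` in `E_2(e)` generate a commutative C*-algebra. -/
@[reducible]
noncomputable def commCStarAlgebra (h : IsSelfAdjointTwo e x) :
    CommCStarAlgebra (powerAlgebra e x) :=
  letI : NormedCommRing (powerAlgebra e x) :=
    { (inferInstance : NormedAddCommGroup (powerAlgebra e x)), h.commRing with
      norm_mul_le := h.norm_mul_le }
  letI : StarRing (powerAlgebra e x) := h.starRing
  letI : Algebra ℂ (powerAlgebra e x) := Algebra.ofModule
    (fun r a b => Subtype.ext (by
      change triple (r • (a : E)) e (b : E) = r • triple (a : E) e (b : E)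
      simp))
    (fun r a b => Subtype.ext (map_smul (triple (a : E) e) r (b : E)))
  -- Cancel one `‖a‖` in `‖a‖³ = ‖aa*a‖ ≤ ‖a*a‖‖a‖`.
  { norm_mul_self_le := fun a => by
      have h1 : ‖a * star a * a‖ = ‖a‖ ^ 3 := by
        have h0 := h.coe_mul_star_mul a a a
        change ‖((a * star a * a : powerAlgebra e x) : E)‖ = ‖(a : E)‖ ^ 3
        exact (congrArg norm h0).trans (norm_cube _)
      have h2 : ‖a‖ ^ 3 ≤ ‖star a * a‖ * ‖a‖ := by
        rw [← h1, mul_comm a (star a)]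
        exact _root_.norm_mul_le _ _
      rcases (norm_nonneg a).eq_or_lt with h0 | hpos
      · rw [← h0]; simp
      · nlinarith
    norm_smul_le := fun r a => norm_smul_le r a
    star_smul := fun r a => Subtype.ext (by
      change triple e (r • (a : E)) e = _
      rw [map_smulₛₗ, LinearMap.smul_apply]; rfl) }

end IsSelfAdjointTwo

end JordanPowers

end JBStarTriple

/-! ### Positivity in C*-algebras. -/

section CStar

variable {A : Type*} [CStarAlgebra A]

/-- The norm inequality is equivalent to positivity for self-adjoint `a`. It is recorded because it
is a closed condition on `E` that does not mention the generated subalgebra, so it survives limits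
in which that subalgebra varies. -/
theorem IsSelfAdjoint.exists_mul_self_and_norm_sub_le {a : A} (ha : IsSelfAdjoint a)
    (h : ∀ ε : ℝ, 0 < ε → ∃ t : ℝ, 0 < t ∧ ‖1 - (t : ℂ) • a‖ ≤ 1 + ε * t) :
    (∃ b : A, star b = b ∧ b * b = a) ∧ ‖(‖a‖ : ℂ) • (1 : A) - a‖ ≤ ‖a‖ := by
  let _ := CStarAlgebra.spectralOrder A
  have _ := CStarAlgebra.spectralOrderedRing A
  have hs : ∀ k ∈ spectrum ℝ a, 0 ≤ k := by
    intro k hk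
    have : Nontrivial A := by
      by_contra hn
      rw [not_nontrivial_iff_subsingleton] at hn
      exact hk (isUnit_of_subsingleton _)
    refine le_of_forall_pos_lt_add fun ε hε => ?_
    obtain ⟨t, ht, hle⟩ := h (ε / 2) (half_pos hε)
    -- A spectral value is bounded by the norm: `1 - tk ≤ 1 + εt/2`, so `k ≥ -ε/2`.
    have hmem : 1 - t * k ∈ spectrum ℝ (1 - (t : ℂ) • a) := by
      rw [spectrum.mem_iff] at hk ⊢
      contrapose! hk
      have hu := hk.smul (Units.mk0 (-t⁻¹) (by simpa using ht.ne'))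
      convert hu using 1
      have e1 : (t : ℂ) • a = t • a := Complex.coe_smul t a
      rw [e1, Units.smul_mk0, Algebra.algebraMap_eq_smul_one, Algebra.algebraMap_eq_smul_one]
      match_scalars <;> field_simp
      ring
    have h1 := (spectrum.norm_le_norm_of_mem hmem).trans hle
    have h2 := (le_abs_self _).trans h1
    nlinarith
  have h0 : 0 ≤ a := (StarOrderedRing.nonneg_iff_spectrum_nonneg (R := ℝ) a).2 hs
  refine ⟨⟨CFC.sqrt a, (CFC.sqrt_nonneg a).isSelfAdjoint, CFC.sqrt_mul_sqrt_self a⟩, ?_⟩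
  have h1 := (SpectrumRestricts.nnreal_iff_nnnorm ha le_rfl).1
    (SpectrumRestricts.nnreal_iff.2 hs)
  have h2 : ‖algebraMap ℝ A ‖a‖ - a‖ ≤ ‖a‖ := h1
  rwa [Algebra.algebraMap_eq_smul_one, ← Complex.coe_smul] at h2

theorem IsSelfAdjoint.eq_zero_of_norm_sub_le {a : A} (ha : IsSelfAdjoint a)
    (h : ‖(‖a‖ : ℂ) • (1 : A) - a‖ ≤ ‖a‖) (h' : ‖(‖-a‖ : ℂ) • (1 : A) - -a‖ ≤ ‖-a‖) : a = 0 := by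
  let _ := CStarAlgebra.spectralOrder A
  have _ := CStarAlgebra.spectralOrderedRing A
  have key : ∀ b : A, IsSelfAdjoint b → ‖(‖b‖ : ℂ) • (1 : A) - b‖ ≤ ‖b‖ → 0 ≤ b := by
    intro b hb hle
    rw [Complex.coe_smul, ← Algebra.algebraMap_eq_smul_one] at hle
    have h1 := (SpectrumRestricts.nnreal_iff_nnnorm hb (t := ‖b‖₊) le_rfl).2 hle
    exact (StarOrderedRing.nonneg_iff_spectrum_nonneg (R := ℝ) b).2
      (SpectrumRestricts.nnreal_iff.1 h1)
  exact le_antisymm (neg_nonneg.1 (key _ ha.neg h')) (key _ ha h)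

end CStar

/-- The spectrum of the commutator `2(AB - BA)` is symmetric if `B² = 0` and `A²B = 0`. -/
theorem neg_mem_spectrum_commutator {𝒜 : Type*} [Ring 𝒜] [Algebra ℂ 𝒜] {A B : 𝒜}
    (hB : B * B = 0) (hA : A * A * B = 0) {z : ℂ}
    (hz : z ∈ spectrum ℂ ((2 : ℂ) • (A * B - B * A))) (hz0 : z ≠ 0) :
    -z ∈ spectrum ℂ ((2 : ℂ) • (A * B - B * A)) := by
  set U := ((2 : ℂ) • A) * B with hU
  set V := B * ((2 : ℂ) • A) with hV
  have hUV : U * V = 0 := by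
    rw [hU, hV, mul_assoc, ← mul_assoc B B, hB, zero_mul, mul_zero]
  have hVU : V * U = 0 := by
    have : V * U = (4 : ℂ) • (B * (A * A * B)) := by
      simp only [hU, hV, smul_mul_assoc, mul_smul_comm, smul_smul, mul_assoc]
      norm_num
    rw [this, hA, mul_zero, smul_zero]
  have hT : (2 : ℂ) • (A * B - B * A) = U - V := by
    rw [hU, hV, smul_sub, smul_mul_assoc, mul_smul_comm]
  rw [hT] at hz ⊢
  -- Since `UV = VU = 0`, `(w - U)(-w - V) = -w(w - (U - V))` with commuting factors. As `U` and `V`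
  -- have the same nonzero spectrum, the resulting condition is symmetric under `w ↦ -w`.
  have key : ∀ w : ℂ, w ≠ 0 → (w ∈ spectrum ℂ (U - V) ↔ w ∈ spectrum ℂ U ∨ -w ∈ spectrum ℂ V) := by
    intro w hw
    have e1 : (algebraMap ℂ 𝒜 w - U) * (algebraMap ℂ 𝒜 (-w) - V) =
        (-w) • (algebraMap ℂ 𝒜 w - (U - V)) := by
      simp only [Algebra.algebraMap_eq_smul_one, sub_mul, mul_sub, hUV, smul_mul_assoc, one_mul,
        mul_smul_comm, mul_one]
      module
    have e2 : (algebraMap ℂ 𝒜 (-w) - V) * (algebraMap ℂ 𝒜 w - U) =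
        (-w) • (algebraMap ℂ 𝒜 w - (U - V)) := by
      simp only [Algebra.algebraMap_eq_smul_one, sub_mul, mul_sub, hVU, smul_mul_assoc, one_mul,
        mul_smul_comm, mul_one]
      module
    have hcomm : Commute (algebraMap ℂ 𝒜 w - U) (algebraMap ℂ 𝒜 (-w) - V) := e1.trans e2.symm
    have h1 := hcomm.isUnit_mul_iff
    have h2 : IsUnit ((-w) • (algebraMap ℂ 𝒜 w - (U - V))) ↔
        IsUnit (algebraMap ℂ 𝒜 w - (U - V)) :=
      isUnit_smul_iff (Units.mk0 (-w) (neg_ne_zero.2 hw)) _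
    rw [e1, h2] at h1
    rw [spectrum.mem_iff, spectrum.mem_iff, spectrum.mem_iff, h1, not_and_or]
  have hswap : ∀ w : ℂ, w ≠ 0 → (w ∈ spectrum ℂ U ↔ w ∈ spectrum ℂ V) := by
    intro w hw
    have h1 := Set.ext_iff.1 (spectrum.nonzero_mul_comm (𝕜 := ℂ) ((2 : ℂ) • A) B) w
    simpa only [Set.mem_sdiff, Set.mem_singleton_iff, hw, not_false_eq_true, and_true] using h1
  have hz0' : -z ≠ 0 := neg_ne_zero.2 hz0
  rw [key _ hz0', neg_neg, hswap _ hz0', ← hswap _ hz0, or_comm]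
  exact (key _ hz0).1 hz

/-! ### Positivity and definiteness of `F₁`. -/

namespace JBStarTriple

variable {E : Type*} [NormedAddCommGroup E] [NormedSpace ℂ E] [CompleteSpace E] [JBStarTriple E]
  {e x : E}

theorem IsSelfAdjointTwo.mem_powerAlgebra (h : IsSelfAdjointTwo e x) : x ∈ powerAlgebra e x := by
  have h1 := jpow_mem_powerAlgebra (e := e) (x := x) 1
  rwa [h.jpow_one] at h1

theorem IsSelfAdjointTwo.isPositive (h : IsSelfAdjointTwo e x)
    (hx : ∀ ε : ℝ, 0 < ε → ∃ t : ℝ, 0 < t ∧ ‖e - (t : ℂ) • x‖ ≤ 1 + ε * t) :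
    IsPositive h.tripotent ⟨x, h.mem⟩ ∧ ‖(‖x‖ : ℂ) • e - x‖ ≤ ‖x‖ := by
  let _ := h.commCStarAlgebra
  have hsa : IsSelfAdjoint (⟨x, h.mem_powerAlgebra⟩ : powerAlgebra e x) := Subtype.ext h.star_eq
  obtain ⟨⟨b, hb1, hb2⟩, hn⟩ := hsa.exists_mul_self_and_norm_sub_le hx
  exact ⟨⟨⟨b, h.powerAlgebra_le_peirce b.2⟩, Subtype.ext (congrArg (fun c : powerAlgebra e x => (c : E)) hb1),
    Subtype.ext (congrArg (fun c : powerAlgebra e x => (c : E)) hb2)⟩, hn⟩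

theorem IsSelfAdjointTwo.eq_zero (h : IsSelfAdjointTwo e x)
    (h1 : ‖(‖x‖ : ℂ) • e - x‖ ≤ ‖x‖) (h2 : ‖(‖-x‖ : ℂ) • e - -x‖ ≤ ‖-x‖) : x = 0 := by
  let _ := h.commCStarAlgebra
  have hsa : IsSelfAdjoint (⟨x, h.mem_powerAlgebra⟩ : powerAlgebra e x) := Subtype.ext h.star_eq
  exact congrArg Subtype.val (hsa.eq_zero_of_norm_sub_le h1 h2)

theorem IsTripotent.isSelfAdjointTwo (he : IsTripotent e) {a : E} (ha : a ∈ peirce e 1) :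
    IsSelfAdjointTwo e (triple a a e) :=
  ⟨he, triple_mem_of_one_one he ha ha, he.quad_triple_one_one ha ha⟩

theorem IsTripotent.isPositive_triple (he : IsTripotent e) {a : E} (ha : a ∈ peirce e 1) :
    IsPositive he ⟨triple a a e, triple_mem_of_one_one he ha ha⟩ ∧
      ‖(‖triple a a e‖ : ℂ) • e - triple a a e‖ ≤ ‖triple a a e‖ := by
  refine (he.isSelfAdjointTwo ha).isPositive fun ε hε => ?_
  obtain ⟨t, ht, hle⟩ :=
    (isHermitianOp_boxOp a).exists_norm_one_sub_smul_le (spectrum_boxOp_nonneg a) hε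
  refine ⟨t, ht, ?_⟩
  calc ‖e - (t : ℂ) • triple a a e‖ = ‖(1 - (t : ℂ) • boxOp a a) e‖ := rfl
    _ ≤ ‖1 - (t : ℂ) • boxOp a a‖ * ‖e‖ := ContinuousLinearMap.le_opNorm _ _
    _ ≤ (1 + ε * t) * 1 := by gcongr; exact he.norm_le_one
    _ = _ := mul_one _

theorem IsTripotent.norm_sub_triple_add_le (he : IsTripotent e) {a b : E} (ha : a ∈ peirce e 1)
    (hb : b ∈ peirce e 1) (h0 : triple a a e = 0) :
    ‖(‖triple a b e + triple b a e‖ : ℂ) • e - (triple a b e + triple b a e)‖ ≤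
      ‖triple a b e + triple b a e‖ := by
  set y := triple a b e + triple b a e with hy
  set w := triple b b e
  have key : ∀ s : ℝ, 0 < s → ‖(‖y + (s : ℂ) • w‖ : ℂ) • e - (y + (s : ℂ) • w)‖ ≤
      ‖y + (s : ℂ) • w‖ := by
    intro s hs
    have h1 := (he.isPositive_triple (Submodule.add_mem _ ha (Submodule.smul_mem _ (s : ℂ) hb))).2
    have h2 : triple (a + (s : ℂ) • b) (a + (s : ℂ) • b) e = (s : ℂ) • (y + (s : ℂ) • w) := by
      simp only [map_add, map_smul, map_smulₛₗ, LinearMap.add_apply, LinearMap.smul_apply,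
        Complex.conj_ofReal, h0, hy]
      module
    rw [h2, norm_smul, Complex.norm_real, Real.norm_of_nonneg hs.le, Complex.ofReal_mul, mul_smul,
      ← smul_sub, norm_smul, Complex.norm_real, Real.norm_of_nonneg hs.le] at h1
    exact le_of_mul_le_mul_left h1 hs
  have hlim : Tendsto (fun s : ℝ => y + (s : ℂ) • w) (𝓝[>] 0) (𝓝 y) := by
    have hc : Continuous fun s : ℝ => y + (s : ℂ) • w := by fun_prop
    have h1 := hc.tendsto 0
    simp only [Complex.ofReal_zero, zero_smul, add_zero] at h1
    exact h1.mono_left nhdsWithin_le_nhds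
  have hcl : IsClosed {p : E | ‖(‖p‖ : ℂ) • e - p‖ ≤ ‖p‖} :=
    isClosed_le (by fun_prop) (by fun_prop)
  exact hcl.mem_of_tendsto hlim (by filter_upwards [self_mem_nhdsWithin] with s hs using key s hs)

theorem IsTripotent.triple_eq_zero (he : IsTripotent e) {a b : E} (ha : a ∈ peirce e 1)
    (hb : b ∈ peirce e 1) (h0 : triple a a e = 0) : triple b a e = 0 := by
  have key : ∀ b ∈ peirce e 1, triple a b e + triple b a e = 0 := by
    intro b hb
    have h1 : IsSelfAdjointTwo e (triple a b e + triple b a e) :=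
      ⟨he, Submodule.add_mem _ (triple_mem_of_one_one he ha hb) (triple_mem_of_one_one he hb ha), by
        rw [map_add, LinearMap.add_apply, he.quad_triple_one_one ha hb,
          he.quad_triple_one_one hb ha, add_comm]⟩
    refine h1.eq_zero (he.norm_sub_triple_add_le ha hb h0) ?_
    have h2 := he.norm_sub_triple_add_le ha (Submodule.neg_mem _ hb) h0
    simpa only [map_neg, LinearMap.neg_apply, ← neg_add] using h2
  have h1 := key b hb
  -- Conjugate linearity gives `-i{a,b,e} + i{b,a,e} = 0`, which separates the two summands.
  have h2 := key (Complex.I • b) (Submodule.smul_mem _ _ hb)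
  simp only [map_smul, map_smulₛₗ, LinearMap.smul_apply, Complex.conj_I] at h2
  have h3 : (2 * Complex.I) • triple b a e = 0 := by
    linear_combination (norm := module) (1 : ℂ) • h2 + Complex.I • h1
  exact (smul_eq_zero.1 h3).resolve_left (by simp)

theorem IsTripotent.eq_zero_of_triple_eq_zero (he : IsTripotent e) {a : E} (ha : a ∈ peirce e 1)
    (h0 : triple a a e = 0) : a = 0 := by
  have hB1 : ∀ b ∈ peirce e 1, triple e a b = 0 := fun b hb => by
    rw [triple_symm]; exact he.triple_eq_zero ha hb h0
  have hB : ∀ y : E, triple e a y ∈ peirce e 1 := by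
    intro y
    obtain ⟨y₀, h0, y₁, h1, y₂, h2, rfl⟩ := he.exists_peirce_add y
    rw [map_add, map_add, hB1 _ h1, he.triple_one_two ha h2, add_zero, add_zero]
    exact he.triple_one_zero_mem ha h0
  -- `L(e,a)` maps `E` into `E_1(e)` and kills it; `L(a,e)` maps `E_1(e)` into `E_0(e)` and kills
  -- `E_0(e)`.
  have hBB : boxOp e a * boxOp e a = 0 := ContinuousLinearMap.ext fun y => hB1 _ (hB y)
  have hAAB : boxOp a e * boxOp a e * boxOp e a = 0 := ContinuousLinearMap.ext fun y =>
    he.triple_one_tripotent_zero ha (he.triple_one_tripotent_one_mem ha (hB y))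
  have hT : boxOp a a = (2 : ℂ) • (boxOp a e * boxOp e a - boxOp e a * boxOp a e) := by
    ext y
    have h1 := jordan a e e a y
    rw [triple_symm a e e, mem_peirce_one.1 ha, triple_symm e a a, h0, map_zero,
      LinearMap.zero_apply, map_smul, LinearMap.smul_apply, LinearMap.smul_apply] at h1
    change triple a a y = (2 : ℂ) • (triple a e (triple e a y) - triple e a (triple a e y))
    linear_combination (norm := module) (-2 : ℂ) • h1
  have hs := spectrum_boxOp_nonneg a
  have hzero : boxOp a a = 0 := by
    refine (isHermitianOp_boxOp a).eq_zero fun z hz => ?_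
    by_contra hz0
    obtain ⟨h1, h2⟩ := hs z hz
    rw [hT] at hz hs
    have h3 := (hs _ (neg_mem_spectrum_commutator hBB hAAB hz hz0)).1
    rw [Complex.neg_re] at h3
    exact hz0 (Complex.ext (by simpa using le_antisymm (by linarith) h1) h2)
  have h1 : triple a a a = 0 := congrArg (fun T : E →L[ℂ] E => T a) hzero
  have h2 := norm_cube a
  rw [h1, norm_zero] at h2
  exact norm_eq_zero.1 (pow_eq_zero_iff (by norm_num) |>.1 h2.symm)

end JBStarTriple

theorem lemma2 {E : Type*} [NormedAddCommGroup E] [NormedSpace ℂ E] [CompleteSpace E]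
    [JBStarTriple E] (e : E) (he : JBStarTriple.IsTripotent e) :
    (∀ a b : JBStarTriple.peirce e 1,
      JBStarTriple.peirceTwoStar he (JBStarTriple.F₁ he a b) = JBStarTriple.F₁ he b a) ∧
    (∀ a : JBStarTriple.peirce e 1, JBStarTriple.IsPositive he (JBStarTriple.F₁ he a a)) ∧
    (∀ a : JBStarTriple.peirce e 1, JBStarTriple.F₁ he a a = 0 ↔ a = 0) := by
  refine ⟨fun a b => Subtype.ext (he.quad_triple_one_one a.2 b.2),
    fun a => (he.isPositive_triple a.2).1, fun a => ⟨fun h => Subtype.ext ?_, ?_⟩⟩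
  · exact he.eq_zero_of_triple_eq_zero a.2 (congrArg Subtype.val h)
  · rintro rfl
    simp
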